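/- \textbf{Theorem (Container Lemma for Halfspaces).} A halfspace in $\mathbb{R}^d$ is a set of the form $\{x : \langle a,x\rangle < b\}$ or $\{x : \langle a,x\rangle \le b\}$ with $0\ne a\in\mathbb{R}^d$ and $b\in\mathbb{R}$. For $U\subseteq\mathbb{R}^d$ let $\mathsf{HS}(U)=\{H\cap U : H \text{ a halfspace in } \mathbb{R}^d\}$. For a finite set $X$ and $\mathcal{F}\subseteq 2^X$, a family $\mathcal{C}\subseteq 2^X$ is a family of $\varepsilon$-containers for $\mathcal{F}$ if for every $F\in\mathcal{F}$ there is $C\in\mathcal{C}$ with $F\subseteq C$ and $|C\setminus F|\le\varepsilon|X|$. There is an absolute constant $K\in\mathbb{N}$ such that for every integer $d\ge 1$, every finite set $U\subseteq\mathbb{R}^d$ and every real $\varepsilon>0$, there is a family $\mathcal{C}$ of $\varepsilon$-containers for $\mathsf{HS}(U)$ of size \[ |\mathcal{C}| \le \bigl(\max\{2,\, d/\varepsilon\}\bigr)^{Kd}. \] In particular, $|\mathcal{C}|\le (d/\varepsilon)^{Kd}$ whenever $d/\varepsilon\ge 2$ (for example, whenever $d\ge 2$ and $\varepsilon\le 1$).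 -/

import Mathlib

/-- The family of all halfspaces in `ℝ^d`, open and closed: the sets `{x | ⟪a, x⟫ < b}` and
`{x | ⟪a, x⟫ ≤ b}` with normal vector `a ≠ 0` and `b` real.  (Replacing `(a, b)` by `(-a, -b)`
gives the sets defined by `>` and `≥`, so the family is closed under complements.) -/
def halfspaces (d : ℕ) : Set (Set (EuclideanSpace ℝ (Fin d))) :=
  {H | ∃ (a : EuclideanSpace ℝ (Fin d)) (b : ℝ), a ≠ 0 ∧
    (H = {x | inner ℝ a x < b} ∨ H = {x | inner ℝ a x ≤ b})}

/-- `HS(U) = {H ∩ U : H a halfspace}`, the family of halfspaces restricted to `U`. -/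
def halfspacesOn {d : ℕ} (U : Set (EuclideanSpace ℝ (Fin d))) :
    Set (Set (EuclideanSpace ℝ (Fin d))) :=
  {F | ∃ H ∈ halfspaces d, F = H ∩ U}

/-- For a finite set `X` and a family `𝓕` of subsets of `X`: `𝓒` is a family of subsets of `X`,
and every `F ∈ 𝓕` is contained in some `C ∈ 𝓒` with `|C \ F| ≤ ε |X|`. -/
def IsContainerFamily {α : Type*} (X : Set α) (𝓕 𝓒 : Set (Set α)) (ε : ℝ) : Prop :=
  (∀ C ∈ 𝓒, C ⊆ X) ∧
    ∀ F ∈ 𝓕, ∃ C ∈ 𝓒, F ⊆ C ∧ ((C \ F).ncard : ℝ) ≤ ε * (X.ncard : ℝ)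

open Module Finset

namespace HalfspaceContainers

/-! ### Random samples hitting large sets -/

section Sampling

/-! Lift a point x to the functional (a, b) ↦ b − ⟨a, x⟩ on ℝ^d × ℝ. A halfspace becomes a vector p:
it contains the points whose functional is positive at p. Sampled points, polynomially many in
max{2, d/ε}, together with a basis of functionals cut the space into faces, and each face is divided
into cones with at most d + 1 generators.

The container of p consists of the points positive at some generator of a cone in which p is a
positive combination. It contains the halfspace, and an excess point must be positive at one
generator and negative at another. A generator is fixed by a sign and d functionals, so the set of
these crossing points is determined by at most d(d + 1) sampled points. For a good sample
(`exists_sample`) it is small or contains a sampled point; the latter is impossible, since sampled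
functionals do not change sign on a face.

Cones are counted by sign patterns (`card_positive_sets_le`) and flags
(`exists_isPosComb_coneRays`). -/

theorem card_bad_le {α : Type*} [Fintype α] {s : ℕ} (Φ : (Fin s → α) → Finset α)
    (J : Finset (Fin s)) (hdep : ∀ w w', (∀ j ∈ J, w j = w' j) → Φ w = Φ w')
    {ε : ℝ} (hε : ε ≤ 1) (B : Finset (Fin s → α))
    (hB : ∀ w ∈ B, ε * Fintype.card α < #(Φ w) ∧ ∀ j, w j ∉ Φ w) :
    (#B : ℝ) ≤ (Fintype.card α : ℝ) ^ s * (1 - ε) ^ (s - #J) := by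
  classical
  set n := Fintype.card α with hn
  let r : (Fin s → α) → (J → α) := fun w j => w j
  -- Once the coordinates in `J` are fixed, `Φ` is a fixed set, and each of the other s − |J|
  -- coordinates must avoid its more than ε n points.
  have hfib : ∀ u : J → α, (#{w ∈ B | r w = u} : ℝ) ≤ (n * (1 - ε)) ^ (s - #J) := by
    intro u
    rcases ({w ∈ B | r w = u} : Finset (Fin s → α)).eq_empty_or_nonempty with h | ⟨w₀, h₀⟩
    · rw [h, card_empty, Nat.cast_zero]
      exact pow_nonneg (mul_nonneg (Nat.cast_nonneg _) (by linarith)) _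
    · rw [mem_filter] at h₀
      have hsub : ({w ∈ B | r w = u} : Finset (Fin s → α)) ⊆
          Fintype.piFinset (fun j => if j ∈ J then {w₀ j} else univ \ Φ w₀) := by
        intro w hw
        rw [mem_filter] at hw
        have hJ : ∀ j ∈ J, w j = w₀ j := fun j hj => by
          have := congrFun (hw.2.trans h₀.2.symm) ⟨j, hj⟩
          exact this
        rw [Fintype.mem_piFinset]
        intro j
        split_ifs with hj
        · exact mem_singleton.2 (hJ j hj)
        · rw [mem_sdiff, ← hdep w w₀ hJ]
          exact ⟨mem_univ _, (hB w hw.1).2 j⟩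
      have hcard : #(Fintype.piFinset (fun j => if j ∈ J then {w₀ j} else univ \ Φ w₀)) =
          (n - #(Φ w₀)) ^ (s - #J) := by
        rw [Fintype.card_piFinset, ← prod_compl_mul_prod J]
        rw [prod_congr rfl (g := fun _ => n - #(Φ w₀)), prod_const,
          prod_congr (s₁ := J) rfl (g := fun _ => 1), prod_const_one, mul_one, card_compl,
          Fintype.card_fin]
        · intro j hj; rw [if_pos hj, card_singleton]
        · intro j hj
          rw [if_neg (mem_compl.1 hj), card_sdiff_of_subset (subset_univ _), card_univ]
      have hle : ((n - #(Φ w₀) : ℕ) : ℝ) ≤ n * (1 - ε) := by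
        rw [Nat.cast_sub (card_le_univ _)]
        linarith [(hB w₀ h₀.1).1]
      calc (#{w ∈ B | r w = u} : ℝ) ≤ ((n - #(Φ w₀)) ^ (s - #J) : ℕ) := by
            exact_mod_cast (card_le_card hsub).trans_eq hcard
        _ ≤ _ := by
            rw [Nat.cast_pow]
            exact pow_le_pow_left₀ (Nat.cast_nonneg _) hle _
  have hsum : #B = ∑ u : J → α, #{w ∈ B | r w = u} :=
    card_eq_sum_card_fiberwise fun _ _ => mem_univ _
  have hJs : #J ≤ s := by simpa using card_le_univ J
  calc (#B : ℝ) = ∑ u : J → α, (#{w ∈ B | r w = u} : ℝ) := by rw [hsum, Nat.cast_sum]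
    _ ≤ ∑ _u : J → α, (n * (1 - ε)) ^ (s - #J) := sum_le_sum fun u _ => hfib u
    _ = (n : ℝ) ^ #J * (n * (1 - ε)) ^ (s - #J) := by
        rw [sum_const, card_univ, Fintype.card_fun, Fintype.card_coe, nsmul_eq_mul, Nat.cast_pow]
    _ = _ := by
        rw [mul_pow, ← mul_assoc, ← pow_add, Nat.add_sub_cancel' hJs]

/-- A sample hits every large set determined by few of its own elements. -/
theorem exists_sample {α τ : Type*} [Fintype α] [Nonempty α] [Fintype τ] {s D : ℕ}
    (Φ : τ → (Fin s → α) → Finset α) (J : τ → Finset (Fin s)) (hJ : ∀ t, #(J t) ≤ D)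
    (hdep : ∀ t w w', (∀ j ∈ J t, w j = w' j) → Φ t w = Φ t w')
    {ε : ℝ} (hε₀ : 0 ≤ ε) (hε : ε ≤ 1)
    (h : (Fintype.card τ : ℝ) * (1 - ε) ^ (s - D) < 1) :
    ∃ w, ∀ t, (#(Φ t w) : ℝ) ≤ ε * Fintype.card α ∨ ∃ j, w j ∈ Φ t w := by
  classical
  by_contra! hcon
  let B : τ → Finset (Fin s → α) := fun t =>
    {w | ε * Fintype.card α < #(Φ t w) ∧ ∀ j, w j ∉ Φ t w}
  have hcover : (univ : Finset (Fin s → α)) ⊆ univ.biUnion B := fun w _ => by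
    obtain ⟨t, ht⟩ := hcon w
    exact mem_biUnion.2 ⟨t, mem_univ _, mem_filter.2 ⟨mem_univ _, ht⟩⟩
  have hpos : (0 : ℝ) < (Fintype.card α : ℝ) ^ s :=
    pow_pos (Nat.cast_pos.2 Fintype.card_pos) _
  have hB : ∀ t, (#(B t) : ℝ) ≤ (Fintype.card α : ℝ) ^ s * (1 - ε) ^ (s - D) := fun t =>
    (card_bad_le (Φ t) (J t) (hdep t) hε (B t) fun w hw => (mem_filter.1 hw).2).trans <|
      mul_le_mul_of_nonneg_left (pow_le_pow_of_le_one (by linarith) (by linarith)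
        (Nat.sub_le_sub_left (hJ t) s)) hpos.le
  have h₁ : ((Fintype.card α : ℝ) ^ s) ≤ ∑ t, (#(B t) : ℝ) := by
    have := (card_le_card hcover).trans card_biUnion_le
    rw [card_univ, Fintype.card_fun, Fintype.card_fin] at this
    exact_mod_cast this
  have h₂ := h₁.trans (sum_le_sum fun t _ => hB t)
  rw [sum_const, card_univ, nsmul_eq_mul] at h₂
  nlinarith

end Sampling

/-! ### Faces of the arrangement and their extremal rays -/

section Cones

variable {V ι : Type*} [AddCommGroup V] [Module ℝ V] (φ : ι → Dual ℝ V)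

/-- The closed face with positive functionals `P` and negative functionals `Q`. -/
def face (P Q : Finset ι) : Set V :=
  {q | (∀ i ∉ P, φ i q ≤ 0) ∧ ∀ i ∉ Q, 0 ≤ φ i q}

variable {φ} {P Q : Finset ι}

theorem smul_mem_face {q : V} (hq : q ∈ face φ P Q) {c : ℝ} (hc : 0 ≤ c) :
    c • q ∈ face φ P Q := by
  refine ⟨fun i hi => ?_, fun i hi => ?_⟩ <;> rw [map_smul, smul_eq_mul]
  · exact mul_nonpos_of_nonneg_of_nonpos hc (hq.1 i hi)
  · exact mul_nonneg hc (hq.2 i hi)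

theorem mul_nonneg_of_mem_face (hPQ : Disjoint P Q) {p q : V} (hp : p ∈ face φ P Q)
    (hq : q ∈ face φ P Q) (i : ι) : 0 ≤ φ i p * φ i q := by
  by_cases hi : i ∈ P
  · have hi' := disjoint_left.1 hPQ hi
    exact mul_nonneg (hp.2 i hi') (hq.2 i hi')
  · exact mul_nonneg_of_nonpos_of_nonpos (hp.1 i hi) (hq.1 i hi)

/-- The ratio test: `t` is the smallest ratio at which some functional shrinking along the walk
reaches zero. Functionals vanishing at `p` also vanish at `w`, so they are never violated. -/
theorem exists_sub_smul_mem_face [Fintype ι] {p w : V} (hp : p ∈ face φ P Q)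
    (hw : ∀ i, φ i p = 0 → φ i w = 0) (hpos : ∃ i, 0 < φ i w * φ i p) :
    ∃ t : ℝ, 0 < t ∧ p - t • w ∈ face φ P Q ∧ ∃ i, φ i p ≠ 0 ∧ φ i (p - t • w) = 0 := by
  classical
  obtain ⟨i₀, hi₀⟩ := hpos
  obtain ⟨i, hi, hmin⟩ := exists_min_image (univ.filter fun i => 0 < φ i w * φ i p)
    (fun i => φ i p / φ i w) ⟨i₀, by simpa using hi₀⟩
  replace hi : 0 < φ i w * φ i p := by simpa using hi
  have hwi : φ i w ≠ 0 := fun h => by simp [h] at hi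
  have hpi : φ i p ≠ 0 := fun h => by simp [h] at hi
  have ht : 0 < φ i p / φ i w := by
    rw [show φ i p / φ i w = (φ i w * φ i p) / (φ i w ^ 2) by field_simp]
    positivity
  refine ⟨φ i p / φ i w, ht, ⟨fun j hj => ?_, fun j hj => ?_⟩, i, hpi, ?_⟩
  · have h₁ := hp.1 j hj
    rw [map_sub, map_smul, smul_eq_mul]
    rcases le_or_gt 0 (φ j w) with h | h
    · linarith [mul_nonneg ht.le h]
    · have h₂ : φ j p < 0 := lt_of_le_of_ne h₁ fun h' => h.ne (hw j h')
      have := hmin j (by simpa using mul_pos_of_neg_of_neg h h₂)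
      rw [le_div_iff_of_neg h] at this
      linarith
  · have h₁ := hp.2 j hj
    rw [map_sub, map_smul, smul_eq_mul]
    rcases le_or_gt (φ j w) 0 with h | h
    · linarith [mul_nonpos_of_nonneg_of_nonpos ht.le h]
    · have h₂ : 0 < φ j p := lt_of_le_of_ne h₁ fun h' => h.ne' (hw j h'.symm)
      have := hmin j (by simpa using mul_pos h h₂)
      rw [le_div_iff₀ h] at this
      linarith
  · rw [map_sub, map_smul, smul_eq_mul, div_mul_cancel₀ _ hwi, sub_self]

theorem eq_zero_of_span_eq_top [FiniteDimensional ℝ V] {s : Set (Dual ℝ V)}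
    (hs : Submodule.span ℝ s = ⊤) {v : V} (hv : ∀ f ∈ s, f v = 0) : v = 0 := by
  have h : Submodule.span ℝ s ≤ LinearMap.ker (Dual.eval ℝ V v) :=
    Submodule.span_le.2 fun f hf => by simpa using hv f hf
  rw [hs] at h
  exact (Module.forall_dual_apply_eq_zero_iff ℝ v).1 fun f => by
    simpa using h (Submodule.mem_top (x := f))

theorem apply_eq_zero_of_mem_span {s : Set (Dual ℝ V)} {v : V} (hv : ∀ f ∈ s, f v = 0)
    {f : Dual ℝ V} (hf : f ∈ Submodule.span ℝ s) : f v = 0 := by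
  have h : Submodule.span ℝ s ≤ LinearMap.ker (Dual.eval ℝ V v) :=
    Submodule.span_le.2 fun f hf => by simpa using hv f hf
  simpa using h hf

/-- Descent on the number of functionals nonzero at `q`: a direction respecting the zeros of `q` but
not proportional to it allows a move within the face that kills one more functional and does not end
at 0. -/
theorem exists_extremal [FiniteDimensional ℝ V] [Fintype ι]
    (hφ : Submodule.span ℝ (Set.range φ) = ⊤) (L : Set ι) {q : V} (hq : q ∈ face φ P Q)
    (hq₀ : q ≠ 0) (hqL : ∀ i ∈ L, φ i q = 0) :
    ∃ v ∈ face φ P Q, v ≠ 0 ∧ (∀ i ∈ L, φ i v = 0) ∧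
      ∀ w, (∀ i, φ i v = 0 → φ i w = 0) → ∃ c : ℝ, w = c • v := by
  classical
  induction hn : #{i | φ i q ≠ 0} using Nat.strong_induction_on generalizing q with
  | _ n ih =>
  by_cases hext : ∀ w, (∀ i, φ i q = 0 → φ i w = 0) → ∃ c : ℝ, w = c • q
  · exact ⟨q, hq, hq₀, hqL, hext⟩
  push Not at hext
  obtain ⟨w, hw, hwq⟩ := hext
  have hw₀ : w ≠ 0 := fun h => hwq 0 (by simp [h])
  obtain ⟨i, hi⟩ : ∃ i, φ i w ≠ 0 := by
    by_contra! h
    exact hw₀ (eq_zero_of_span_eq_top hφ (by rintro _ ⟨i, rfl⟩; exact h i))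
  have hiq : φ i q ≠ 0 := fun h => hi (hw i h)
  obtain ⟨w', hw', hwq', hpos⟩ : ∃ w' : V, (∀ i, φ i q = 0 → φ i w' = 0) ∧
      (∀ c : ℝ, w' ≠ c • q) ∧ ∃ i, 0 < φ i w' * φ i q := by
    rcases lt_or_gt_of_ne (mul_ne_zero hi hiq) with h | h
    · refine ⟨-w, fun i hi => by simp [hw i hi], fun c hc => hwq (-c) ?_, i, by simpa using h⟩
      rw [neg_smul, ← hc, neg_neg]
    · exact ⟨w, hw, hwq, i, h⟩
  obtain ⟨t, ht, hmem, j, hj, hj'⟩ := exists_sub_smul_mem_face hq hw' hpos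
  have hz : ∀ i, φ i q = 0 → φ i (q - t • w') = 0 := fun i hi => by simp [hi, hw' i hi]
  refine ih _ ?_ hmem (fun h => hwq' t⁻¹ ?_) (fun i hi => hz i (hqL i hi)) rfl
  · rw [← hn]
    refine card_lt_card ⟨fun i hi => ?_, fun h => ?_⟩
    · simp only [mem_filter, mem_univ, true_and] at hi ⊢
      exact fun h => hi (hz i h)
    · exact absurd hj' (by simpa using h (by simpa using hj : j ∈ _))
  · rw [sub_eq_zero.1 h, smul_smul, inv_mul_cancel₀ ht.ne', one_smul]

/-- A nonzero vector annihilated by all members of a family of functionals, if there is one. -/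
noncomputable def normalVec {κ : Type*} (f : κ → Dual ℝ V) : V :=
  Classical.epsilon fun v => v ≠ 0 ∧ ∀ j, f j v = 0

theorem normalVec_spec {κ : Type*} {f : κ → Dual ℝ V} (h : ∃ v : V, v ≠ 0 ∧ ∀ j, f j v = 0) :
    normalVec f ≠ 0 ∧ ∀ j, f j (normalVec f) = 0 :=
  Classical.epsilon_spec h

variable (φ) in
/-- The vector with a sign that is normal to `d` members of the family `φ`. -/
noncomputable def signedNormal {d : ℕ} (g : Bool × (Fin d → ι)) : V :=
  (if g.1 then (1 : ℝ) else -1) • normalVec fun j => φ (g.2 j)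

/-- The functionals vanishing at an extremal `v` have rank d, so d of them determine the line
through `v`; the sign selects the half-line. -/
theorem exists_signedNormal_mem_face [FiniteDimensional ℝ V] [Fintype ι] {d : ℕ}
    (hV : finrank ℝ V = d + 1)
    (hφ : Submodule.span ℝ (Set.range φ) = ⊤) (L : Set ι) {q : V} (hq : q ∈ face φ P Q)
    (hq₀ : q ≠ 0) (hqL : ∀ i ∈ L, φ i q = 0) :
    ∃ g : Bool × (Fin d → ι), signedNormal φ g ∈ face φ P Q ∧ signedNormal φ g ≠ 0 ∧
      ∀ i ∈ L, φ i (signedNormal φ g) = 0 := by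
  obtain ⟨v, hv, hv₀, hvL, hext⟩ := exists_extremal hφ L hq hq₀ hqL
  let Z : Set (Dual ℝ V) := φ '' {i | φ i v = 0}
  have hco : (Submodule.span ℝ Z).dualCoannihilator = Submodule.span ℝ {v} := by
    refine le_antisymm (fun w hw => ?_) ?_
    · rw [Submodule.mem_dualCoannihilator] at hw
      obtain ⟨c, rfl⟩ := hext w fun i hi => hw _ (Submodule.subset_span ⟨i, hi, rfl⟩)
      exact Submodule.smul_mem _ _ (Submodule.mem_span_singleton_self v)
    · rw [Submodule.span_singleton_le_iff_mem, Submodule.mem_dualCoannihilator]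
      intro f hf
      exact apply_eq_zero_of_mem_span (by rintro _ ⟨i, hi, rfl⟩; exact hi) hf
  have hrank : finrank ℝ (Submodule.span ℝ Z) = d := by
    have := Subspace.finrank_add_finrank_dualCoannihilator_eq (Submodule.span ℝ Z)
    rw [hco, finrank_span_singleton hv₀, hV] at this
    omega
  have hbasis := Submodule.exists_fun_fin_finrank_span_eq ℝ Z
  rw [hrank] at hbasis
  obtain ⟨f, hfZ, hfspan, -⟩ := hbasis
  choose T hT hTf using hfZ
  obtain rfl : (fun j => φ (T j)) = f := funext hTf
  obtain ⟨hn₀, hn⟩ := normalVec_spec (f := fun j => φ (T j)) ⟨v, hv₀, fun j => hT j⟩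
  obtain ⟨c, hc⟩ := hext (normalVec fun j => φ (T j)) fun i hi =>
    apply_eq_zero_of_mem_span (s := Set.range fun j => φ (T j))
      (by rintro _ ⟨j, rfl⟩; exact hn j)
      (by rw [hfspan]; exact Submodule.subset_span ⟨i, hi, rfl⟩)
  have hc₀ : c ≠ 0 := by
    rintro rfl
    exact hn₀ (by rw [hc, zero_smul])
  refine ⟨(decide (0 < c), T), ?_⟩
  have heq : signedNormal φ (decide (0 < c), T) = |c| • v := by
    rw [signedNormal, hc, smul_smul]
    congr 1
    rcases lt_or_gt_of_ne hc₀ with h | h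
    · simp [h.not_gt, abs_of_neg h]
    · simp [h, abs_of_pos h]
  rw [heq]
  exact ⟨smul_mem_face hv (abs_nonneg c), smul_ne_zero (abs_ne_zero.2 hc₀) hv₀,
    fun i hi => by rw [map_smul, hvL i hi, smul_zero]⟩

end Cones
-- Decomposing a face into cones indexed by flags
section Cells

variable {V ι : Type*} [AddCommGroup V] [Module ℝ V] (φ : ι → Dual ℝ V) (P Q : Finset ι)

/-- `p` is a linear combination of the members of the list with positive coefficients. -/
def IsPosComb : List V → V → Prop
  | [], p => p = 0
  | v :: vs, p => ∃ t : ℝ, 0 < t ∧ IsPosComb vs (p - t • v)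

theorem IsPosComb.apply_nonneg {f : Dual ℝ V} :
    ∀ {vs : List V} {p : V}, IsPosComb vs p → (∀ v ∈ vs, 0 ≤ f v) →
      0 ≤ f p ∧ (f p = 0 → ∀ v ∈ vs, f v = 0)
  | [], p, h, _ => by
      rw [IsPosComb] at h
      simp [h]
  | v :: vs, p, ⟨t, ht, h⟩, hvs => by
      obtain ⟨h₁, h₂⟩ := h.apply_nonneg fun u hu => hvs u (List.mem_cons_of_mem v hu)
      have hv := hvs v List.mem_cons_self
      have htv := mul_nonneg ht.le hv
      rw [map_sub, map_smul, smul_eq_mul] at h₁ h₂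
      refine ⟨by linarith, fun hp u hu => ?_⟩
      rcases List.mem_cons.1 hu with rfl | hu
      · exact (mul_eq_zero.1 (show t * f u = 0 by linarith)).resolve_left ht.ne'
      · exact h₂ (by linarith) u hu

theorem IsPosComb.exists_pos {f : Dual ℝ V} {vs : List V} {p : V} (h : IsPosComb vs p)
    (hp : 0 < f p) : ∃ v ∈ vs, 0 < f v := by
  by_contra! hcon
  have := (h.apply_nonneg (f := -f) fun v hv => by simpa using hcon v hv).1
  rw [LinearMap.neg_apply] at this
  linarith

theorem IsPosComb.exists_neg {f : Dual ℝ V} {vs : List V} {p : V} (h : IsPosComb vs p)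
    (hp : f p ≤ 0) (hpos : ∃ v ∈ vs, 0 < f v) : ∃ v ∈ vs, f v < 0 := by
  by_contra! hcon
  obtain ⟨h₁, h₂⟩ := h.apply_nonneg hcon
  obtain ⟨v, hv, hv'⟩ := hpos
  exact hv'.ne' (h₂ (le_antisymm hp h₁) v hv)

variable [Nonempty ι]

/-- A chosen extremal ray of the face `face φ P Q` in the flat cut out by the list `l`. -/
noncomputable def flatRay (d : ℕ) (l : List ι) : V :=
  signedNormal φ (Classical.epsilon fun g : Bool × (Fin d → ι) => signedNormal φ g ∈ face φ P Q ∧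
    signedNormal φ g ≠ 0 ∧ ∀ i ∈ l, φ i (signedNormal φ g) = 0)

/-- The generators of the simplicial cone encoded by a flag of flats with marks on the flats that
contribute a generator. -/
noncomputable def coneRays (d : ℕ) : List ι → List (ι × Bool) → List V
  | _, [] => []
  | l, (i, b) :: c =>
      if b then flatRay φ P Q d l :: coneRays d (i :: l) c else coneRays d (i :: l) c

variable {φ P Q}

theorem flatRay_spec [FiniteDimensional ℝ V] [Fintype ι] {d : ℕ} (hV : finrank ℝ V = d + 1)
    (hφ : Submodule.span ℝ (Set.range φ) = ⊤) (l : List ι) {q : V} (hq : q ∈ face φ P Q)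
    (hq₀ : q ≠ 0) (hql : ∀ i ∈ l, φ i q = 0) :
    flatRay φ P Q d l ∈ face φ P Q ∧ flatRay φ P Q d l ≠ 0 ∧
      ∀ i ∈ l, φ i (flatRay φ P Q d l) = 0 :=
  Classical.epsilon_spec (p := fun g : Bool × (Fin d → ι) => signedNormal φ g ∈ face φ P Q ∧
    signedNormal φ g ≠ 0 ∧ ∀ i ∈ l, φ i (signedNormal φ g) = 0)
    (exists_signedNormal_mem_face hV hφ {i | i ∈ l} hq hq₀ hql)

theorem length_coneRays_le {d : ℕ} : ∀ (l : List ι) (c : List (ι × Bool)),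
    (coneRays φ P Q d l c).length ≤ c.length
  | _, [] => le_rfl
  | l, (i, b) :: c => by
      have := length_coneRays_le (d := d) (i :: l) c
      rw [coneRays]
      split_ifs <;> simp only [List.length_cons] <;> omega

theorem mem_range_of_mem_coneRays {d : ℕ} : ∀ (l : List ι) (c : List (ι × Bool)),
    ∀ v ∈ coneRays φ P Q d l c, ∃ g : Bool × (Fin d → ι), v = signedNormal φ g
  | _, [], v, hv => by simp [coneRays] at hv
  | l, (i, b) :: c, v, hv => by
      have ih := mem_range_of_mem_coneRays (d := d) (i :: l) c
      rw [coneRays] at hv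
      split_ifs at hv
      · rcases List.mem_cons.1 hv with rfl | hv
        · exact ⟨_, rfl⟩
        · exact ih v hv
      · exact ih v hv

/-- A pulling triangulation. Either `p` already lies on a hyperplane independent of `l` (mark
`false`), or the ray chosen for the flat is subtracted until one is hit (mark `true`). Rays depend
on `P`, `Q` and the flag but not on `p`, which makes the cones countable. By `hl` the list stays
independent, so d + 1 steps end at 0. -/
theorem exists_isPosComb_coneRays [FiniteDimensional ℝ V] [Fintype ι] {d : ℕ}
    (hV : finrank ℝ V = d + 1) (hφ : Submodule.span ℝ (Set.range φ) = ⊤) (hPQ : Disjoint P Q)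
    (k : ℕ) (l : List ι) (p : V) (hk : l.length + k = d + 1)
    (hl : l.length ≤ finrank ℝ (Submodule.span ℝ (φ '' {i | i ∈ l})))
    (hp : p ∈ face φ P Q) (hpl : ∀ i ∈ l, φ i p = 0) :
    ∃ c : List (ι × Bool), c.length = k ∧ IsPosComb (coneRays φ P Q d l c) p ∧
      ∀ v ∈ coneRays φ P Q d l c, v ∈ face φ P Q := by
  classical
  induction k generalizing l p with
  | zero =>
    refine ⟨[], rfl, ?_, by simp [coneRays]⟩
    have htop : Submodule.span ℝ (φ '' {i | i ∈ l}) = ⊤ := by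
      refine Submodule.eq_top_of_finrank_eq (le_antisymm (Submodule.finrank_le _) ?_)
      rw [Subspace.dual_finrank_eq, hV]
      omega
    exact eq_zero_of_span_eq_top htop (by rintro _ ⟨i, hi, rfl⟩; exact hpl i hi)
  | succ k ih =>
    have hker : ∀ q : V, (∀ i ∈ l, φ i q = 0) → ∀ f ∈ Submodule.span ℝ (φ '' {i | i ∈ l}), f q = 0 :=
      fun q hq f hf => apply_eq_zero_of_mem_span (by rintro _ ⟨i, hi, rfl⟩; exact hq i hi) hf
    have hcons : ∀ i, φ i ∉ Submodule.span ℝ (φ '' {i | i ∈ l}) →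
        (i :: l).length ≤ finrank ℝ (Submodule.span ℝ (φ '' {j | j ∈ i :: l})) := fun i hi => by
      refine hl.trans_lt (Submodule.finrank_lt_finrank_of_lt (lt_of_le_of_ne ?_ ?_))
      · exact Submodule.span_mono (Set.image_mono fun j hj => List.mem_cons_of_mem i hj)
      · intro h
        exact hi (h ▸ Submodule.subset_span ⟨i, List.mem_cons_self, rfl⟩)
    have next : ∀ (i : ι) (q : V), φ i ∉ Submodule.span ℝ (φ '' {i | i ∈ l}) → q ∈ face φ P Q →
        (∀ j ∈ i :: l, φ j q = 0) → ∃ c : List (ι × Bool), c.length = k ∧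
          IsPosComb (coneRays φ P Q d (i :: l) c) q ∧
            ∀ v ∈ coneRays φ P Q d (i :: l) c, v ∈ face φ P Q := fun i q hi =>
      ih (i :: l) q (by rw [List.length_cons]; omega) (hcons i hi)
    by_cases hz : ∃ i, φ i p = 0 ∧ φ i ∉ Submodule.span ℝ (φ '' {i | i ∈ l})
    · obtain ⟨i, hi, hil⟩ := hz
      obtain ⟨c, hc, hcp, hcf⟩ := next i p hil hp (List.forall_mem_cons.2 ⟨hi, hpl⟩)
      exact ⟨(i, false) :: c, by simp [hc], by simpa [coneRays] using hcp,
        by simpa [coneRays] using hcf⟩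
    · push Not at hz
      have hp₀ : p ≠ 0 := by
        rintro rfl
        have h₁ : (⊤ : Submodule ℝ (Dual ℝ V)) ≤ Submodule.span ℝ (φ '' {i | i ∈ l}) := by
          rw [← hφ, Submodule.span_le]
          rintro _ ⟨i, rfl⟩
          exact hz i (map_zero _)
        have h₂ : finrank ℝ (Submodule.span ℝ (φ '' {i | i ∈ l})) ≤ l.length := by
          have heq : φ '' {i | i ∈ l} = ((l.map φ).toFinset : Set (Dual ℝ V)) := by
            ext; simp
          rw [heq]
          refine (finrank_span_finset_le_card _).trans ((List.toFinset_card_le _).trans ?_)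
          rw [List.length_map]
        rw [top_le_iff.1 h₁, finrank_top, Subspace.dual_finrank_eq, hV] at h₂
        omega
      obtain ⟨hv, hv₀, hvl⟩ := flatRay_spec hV hφ l hp hp₀ hpl
      set v := flatRay φ P Q d l with hvdef
      have hpv : ∀ i, φ i p = 0 → φ i v = 0 := fun i hi => hker v hvl _ (hz i hi)
      obtain ⟨i₀, hi₀⟩ : ∃ i, φ i v ≠ 0 := by
        by_contra! h
        exact hv₀ (eq_zero_of_span_eq_top hφ (by rintro _ ⟨i, rfl⟩; exact h i))
      obtain ⟨t, ht, hmem, i, hi, hi'⟩ := exists_sub_smul_mem_face hp hpv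
        ⟨i₀, lt_of_le_of_ne (mul_nonneg_of_mem_face hPQ hv hp i₀)
          (mul_ne_zero hi₀ fun h => hi₀ (hpv i₀ h)).symm⟩
      obtain ⟨c, hc, hcp, hcf⟩ := next i (p - t • v) (fun h => hi (hker p hpl _ h)) hmem
        (List.forall_mem_cons.2 ⟨hi', fun j hj => by simp [hpl j hj, hvl j hj]⟩)
      refine ⟨(i, true) :: c, by simp [hc], ?_, ?_⟩
      · simpa [coneRays] using ⟨t, ht, hcp⟩
      · simpa [coneRays] using ⟨hv, hcf⟩

end Cells

/-! ### Counting sign patterns -/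

section Counting

variable {V ι : Type*} [AddCommGroup V] [Module ℝ V] [FiniteDimensional ℝ V] [Fintype ι]
  [DecidableEq ι]

/-- Sauer–Shelah: a shattered set has linearly independent functionals, so the VC dimension is at
most dim V. -/
theorem card_positive_sets_le (φ : ι → Dual ℝ V) (𝒜 : Finset (Finset ι))
    (h𝒜 : ∀ A ∈ 𝒜, ∃ p : V, ∀ i, i ∈ A ↔ 0 < φ i p) :
    #𝒜 ≤ (Fintype.card ι + 1) ^ finrank ℝ V := by
  have hvc : 𝒜.vcDim ≤ finrank ℝ V := by
    refine Finset.sup_le fun S hS => ?_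
    rw [mem_shatterer] at hS
    by_contra! hcard
    have hdep : ¬ LinearIndependent ℝ fun i : S => φ i := fun h => by
      have := h.fintype_card_le_finrank
      rw [Fintype.card_coe, Subspace.dual_finrank_eq] at this
      omega
    obtain ⟨c, hc, i₀, hi₀⟩ := Fintype.not_linearIndependent_iff.1 hdep
    wlog hpos : 0 < c i₀ generalizing c
    · exact this (-c) (by simpa using hc) (by simpa using hi₀)
        (by simpa using lt_of_le_of_ne (not_lt.1 hpos) hi₀)
    -- Cutting out exactly the indices with positive coefficient makes every term of the dependence
    -- at `p` nonnegative and one positive.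
    obtain ⟨A, hA, hSA⟩ := hS (t := S.filter fun i => ∃ h : i ∈ S, 0 < c ⟨i, h⟩) (filter_subset _ _)
    obtain ⟨p, hp⟩ := h𝒜 A hA
    have hmem : ∀ i : S, 0 < φ i p ↔ 0 < c i := fun i => by
      have := congrArg (fun B => (i : ι) ∈ B) hSA
      simpa [hp] using this
    have hzero := congrArg (fun f : Dual ℝ V => f p) hc
    simp only [LinearMap.sum_apply, LinearMap.smul_apply, smul_eq_mul, LinearMap.zero_apply]
      at hzero
    refine (sum_pos' (fun i _ => ?_) ⟨i₀, mem_univ _, ?_⟩).ne' hzero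
    · by_cases h : 0 < c i
      · exact (mul_pos h ((hmem i).2 h)).le
      · exact mul_nonneg_of_nonpos_of_nonpos (not_lt.1 h) (not_lt.1 fun h' => h ((hmem i).1 h'))
    · exact mul_pos hpos ((hmem i₀).2 hpos)
  calc #𝒜 ≤ #𝒜.shatterer := card_le_card_shatterer 𝒜
    _ ≤ ∑ k ∈ Iic 𝒜.vcDim, (Fintype.card ι).choose k := card_shatterer_le_sum_vcDim
    _ ≤ ∑ k ∈ range (finrank ℝ V + 1), (Fintype.card ι).choose k :=
        sum_le_sum_of_subset fun k hk => by
          rw [mem_Iic] at hk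
          rw [mem_range]
          omega
    _ ≤ ∑ k ∈ range (finrank ℝ V + 1),
          Fintype.card ι ^ k * 1 ^ (finrank ℝ V - k) * (finrank ℝ V).choose k :=
        sum_le_sum fun k hk => by
          rw [one_pow, mul_one]
          exact (Nat.choose_le_pow _ _).trans (Nat.le_mul_of_pos_right _
            (Nat.choose_pos (by rw [mem_range] at hk; omega)))
    _ = _ := (add_pow _ _ _).symm

end Counting
-- Containers from a good sample
section Containers

variable {V : Type*} [AddCommGroup V] [Module ℝ V] [FiniteDimensional ℝ V]

open Classical in
theorem exists_containers {α : Type*} [Fintype α] [Nonempty α] (ψ : α → Dual ℝ V) {s d : ℕ}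
    (hV : finrank ℝ V = d + 1) {ε : ℝ} (hε₀ : 0 ≤ ε) (hε : ε ≤ 1)
    (hs : ((2 * (s + (d + 1)) ^ d) ^ (d + 1) : ℝ) * (1 - ε) ^ (s - (d + 1) * d) < 1) :
    ∃ 𝒞 : Finset (Finset α),
      #𝒞 ≤ ((s + (d + 1) + 1) ^ (d + 1)) ^ 2 * (2 * (s + (d + 1))) ^ (d + 1) ∧
      ∀ p : V, ∃ C ∈ 𝒞, (∀ x, 0 < ψ x p → x ∈ C) ∧
        (#{x ∈ C | ψ x p ≤ 0} : ℝ) ≤ ε * Fintype.card α := by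
  -- Adjoining a basis makes the functionals span the dual for every sample; being independent of
  -- the sample, it adds nothing to `J`.
  let b : Basis (Fin (d + 1)) ℝ (Dual ℝ V) :=
    finBasisOfFinrankEq ℝ (Dual ℝ V) (Subspace.dual_finrank_eq.trans hV)
  let φ : (Fin s → α) → Fin s ⊕ Fin (d + 1) → Dual ℝ V := fun w => Sum.elim (fun j => ψ (w j)) b
  have hφ : ∀ w, Submodule.span ℝ (Set.range (φ w)) = ⊤ := fun w => by
    rw [eq_top_iff, ← b.span_eq]
    refine Submodule.span_mono ?_
    rintro _ ⟨j, rfl⟩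
    exact ⟨Sum.inr j, rfl⟩
  let τ := Fin (d + 1) → Bool × (Fin d → Fin s ⊕ Fin (d + 1))
  let Φ : τ → (Fin s → α) → Finset α := fun g w =>
    {x | (∃ k, 0 < ψ x (signedNormal (φ w) (g k))) ∧ ∃ k, ψ x (signedNormal (φ w) (g k)) < 0}
  let J : τ → Finset (Fin s) := fun g =>
    (univ ×ˢ univ : Finset (Fin (d + 1) × Fin d)).biUnion fun k =>
      Sum.elim (fun j => {j}) (fun _ => ∅) ((g k.1).2 k.2)
  obtain ⟨w, hw⟩ := exists_sample (D := (d + 1) * d) Φ J (fun g => by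
      refine (card_biUnion_le_card_mul _ _ 1 fun k _ => ?_).trans (by simp)
      rcases (g k.1).2 k.2 with j | j <;> simp)
    (fun g w w' h => by
      -- `normalVec` is chosen from the functionals alone, so equal functionals give the same
      -- normal.
      have hnormal : ∀ k, signedNormal (φ w) (g k) = signedNormal (φ w') (g k) := fun k => by
        have : (fun i => φ w ((g k).2 i)) = fun i => φ w' ((g k).2 i) := funext fun i => by
          rcases hgi : (g k).2 i with j | j
          · exact congrArg ψ (h j (mem_biUnion.2 ⟨(k, i), by simp, by simp [hgi]⟩))
          · rfl
        rw [signedNormal, signedNormal, this]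
      simp only [Φ, hnormal]) hε₀ hε (by
      refine lt_of_eq_of_lt ?_ hs
      simp [τ])
  let 𝒜 : Finset (Finset (Fin s ⊕ Fin (d + 1))) :=
    {A | ∃ p : V, ∀ i, i ∈ A ↔ 0 < φ w i p}
  have h𝒜 : #𝒜 ≤ (s + (d + 1) + 1) ^ (d + 1) := by
    have := card_positive_sets_le (φ w) 𝒜 fun A hA => (mem_filter.1 hA).2
    simpa [hV] using this
  let cell : Finset (Fin s ⊕ Fin (d + 1)) × Finset (Fin s ⊕ Fin (d + 1)) ×
      (Fin (d + 1) → (Fin s ⊕ Fin (d + 1)) × Bool) → Finset α := fun e =>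
    {x | ∃ v ∈ coneRays (φ w) e.1 e.2.1 d [] (List.ofFn e.2.2), 0 < ψ x v}
  refine ⟨(𝒜 ×ˢ 𝒜 ×ˢ univ).image cell, ?_, fun p => ?_⟩
  · refine card_image_le.trans ?_
    rw [card_product, card_product, ← mul_assoc, sq, card_univ]
    refine Nat.mul_le_mul (Nat.mul_le_mul h𝒜 h𝒜) (le_of_eq ?_)
    simp [mul_comm]
  · let P : Finset (Fin s ⊕ Fin (d + 1)) := {i | 0 < φ w i p}
    let Q : Finset (Fin s ⊕ Fin (d + 1)) := {i | φ w i p < 0}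
    have hPQ : Disjoint P Q := disjoint_filter.2 fun i _ h => h.not_gt
    obtain ⟨c, hc, hcp, hcf⟩ := exists_isPosComb_coneRays (P := P) (Q := Q) hV (hφ w) hPQ
      (d + 1) [] p (by simp) (by simp)
      ⟨fun i hi => by simpa [P] using hi, fun i hi => by simpa [Q] using hi⟩ (by simp)
    obtain ⟨e, rfl⟩ : ∃ e : Fin (d + 1) → (Fin s ⊕ Fin (d + 1)) × Bool, List.ofFn e = c :=
      ⟨fun i => c.get (i.cast hc.symm), List.ext_getElem (by rw [List.length_ofFn, hc]) fun i _ _ => List.getElem_ofFn _⟩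
    have hlen := (length_coneRays_le (φ := φ w) (P := P) (Q := Q) (d := d) [] (List.ofFn e))
    have hrange := mem_range_of_mem_coneRays (φ := φ w) (P := P) (Q := Q) (d := d) [] (List.ofFn e)
    rw [hc] at hlen
    refine ⟨cell (P, Q, e), mem_image_of_mem _ ?_, fun x hx => ?_, ?_⟩
    · refine mem_product.2 ⟨mem_filter.2 ⟨mem_univ _, p, fun i => by simp [P]⟩,
        mem_product.2 ⟨mem_filter.2 ⟨mem_univ _, -p, fun i => by simp [Q]⟩, mem_univ _⟩⟩
    · exact mem_filter.2 ⟨mem_univ _, hcp.exists_pos hx⟩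
    simp only [cell, filter_filter]
    generalize coneRays (φ w) P Q d [] (List.ofFn e) = vs at *
    rcases vs with _ | ⟨v₀, vs⟩
    · simpa using mul_nonneg hε₀ (Nat.cast_nonneg _)
    -- A cone may have fewer than d + 1 generators; repeating `v₀` pads the list to the length
    -- required by `τ`.
    have hget : ∀ k : ℕ, (((v₀ :: vs)[k]?).getD v₀) ∈ v₀ :: vs := fun k => by
      rcases h : (v₀ :: vs)[k]? with _ | u
      · simp
      · exact List.mem_of_getElem? h
    choose g hg using fun k : Fin (d + 1) => hrange _ (hget k)
    have hindex : ∀ v ∈ v₀ :: vs, ∃ k, signedNormal (φ w) (g k) = v := fun v hv => by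
      obtain ⟨k, hk, rfl⟩ := List.mem_iff_getElem.1 hv
      exact ⟨⟨k, hk.trans_le hlen⟩, by rw [← hg, List.getElem?_eq_getElem hk, Option.getD_some]⟩
    rcases hw g with h | ⟨j, hj⟩
    · refine le_trans (Nat.cast_le.2 (card_le_card fun x hx => ?_)) h
      obtain ⟨-, hpos, hx⟩ := mem_filter.1 hx
      obtain ⟨u, hu, hu'⟩ := hcp.exists_neg hx hpos
      obtain ⟨v, hv, hv'⟩ := hpos
      obtain ⟨k, rfl⟩ := hindex v hv
      obtain ⟨k', rfl⟩ := hindex u hu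
      exact mem_filter.2 ⟨mem_univ _, ⟨k, hv'⟩, k', hu'⟩
    · obtain ⟨-, ⟨k, hk⟩, k', hk'⟩ := mem_filter.1 hj
      have := mul_nonneg_of_mem_face hPQ (hcf _ (hget k)) (hcf _ (hget k')) (Sum.inl j)
      rw [hg, hg] at this
      exact absurd this (mul_neg_of_pos_of_neg hk hk').not_ge

end Containers

/-! ### Choice of the sample size -/

section Numerics

/-- The logarithm of the first factor is at most about 26 B³, while ε s ≥ B¹⁰. -/
theorem pow_mul_one_sub_pow_lt_one {B ε : ℝ} {s d : ℕ} (hB : 2 ≤ B) (hε₀ : 0 < ε) (hε : ε ≤ 1)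
    (hBε : ε⁻¹ ≤ B) (hd : 1 ≤ d) (hBd : d ≤ B) (hs : B ^ 11 ≤ s)
    (hN : (s : ℝ) + (d + 1) ≤ B ^ 12) :
    ((2 * (s + (d + 1)) ^ d) ^ (d + 1) : ℝ) * (1 - ε) ^ (s - (d + 1) * d) < 1 := by
  have hB₀ : 0 < B := by linarith
  have hd' : (1 : ℝ) ≤ d := by exact_mod_cast hd
  have h₁ : ((2 * (s + (d + 1)) ^ d) ^ (d + 1) : ℝ) ≤ B ^ (13 * ((d + 1) * d)) := by
    have : (2 * (s + (d + 1)) ^ d : ℝ) ≤ B ^ (13 * d) := calc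
      (2 * (s + (d + 1)) ^ d : ℝ) ≤ B ^ d * (B ^ 12) ^ d := by
        gcongr
        exact hB.trans (le_self_pow₀ (by linarith) (by omega))
      _ = B ^ (13 * d) := by rw [← pow_mul, ← pow_add]; congr 1; ring
    calc _ ≤ (B ^ (13 * d)) ^ (d + 1) := by gcongr
      _ = _ := by rw [← pow_mul]; congr 1; ring
  have h₂ : B ^ (13 * ((d + 1) * d)) ≤ Real.exp ((13 * ((d + 1) * d) : ℕ) * (B - 1)) := by
    rw [Real.exp_nat_mul]
    gcongr
    linarith [Real.add_one_le_exp (B - 1)]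
  have h₃ : (1 - ε) ^ (s - (d + 1) * d) ≤ Real.exp ((s - (d + 1) * d : ℕ) * (-ε)) := by
    rw [Real.exp_nat_mul]
    gcongr
    linarith [Real.add_one_le_exp (-ε)]
  have h₄ : B ^ 10 ≤ ε * s := by
    have : 1 ≤ ε * B := by
      rwa [inv_le_iff_one_le_mul₀ hε₀, mul_comm] at hBε
    calc B ^ 10 ≤ (ε * B) * B ^ 10 := le_mul_of_one_le_left (by positivity) this
      _ = ε * B ^ 11 := by ring
      _ ≤ ε * s := by gcongr
  have h₅ : (s : ℝ) - (d + 1) * d ≤ ((s - (d + 1) * d : ℕ) : ℝ) := by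
    have : s ≤ (s - (d + 1) * d) + (d + 1) * d := le_tsub_add
    have : (s : ℝ) ≤ ((s - (d + 1) * d : ℕ) : ℝ) + (d + 1) * d := by exact_mod_cast this
    linarith
  have h₆ : ((d : ℝ) + 1) * d ≤ 2 * B ^ 2 := by nlinarith
  have h₇ : 26 * B ^ 3 < B ^ 10 := by
    have : (2 : ℝ) ^ 7 ≤ B ^ 7 := by gcongr
    have h3 : 0 < B ^ 3 := by positivity
    calc 26 * B ^ 3 < B ^ 7 * B ^ 3 := by gcongr; linarith
      _ = B ^ 10 := by ring
  have hDB : ((d : ℝ) + 1) * d * B ≤ 2 * B ^ 3 := by nlinarith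
  calc _ ≤ Real.exp ((13 * ((d + 1) * d) : ℕ) * (B - 1)) *
        Real.exp ((s - (d + 1) * d : ℕ) * (-ε)) :=
        mul_le_mul (h₁.trans h₂) h₃ (pow_nonneg (by linarith) _) (Real.exp_pos _).le
    _ < 1 := by
      rw [← Real.exp_add, Real.exp_lt_one_iff]
      push_cast
      have h₈ := mul_le_mul_of_nonneg_right h₅ hε₀.le
      have h₉ : ((d : ℝ) + 1) * d * ε ≤ (d + 1) * d * 1 := by gcongr
      nlinarith

/-- Sign patterns contribute 24(d + 1) to the exponent and flags 13(d + 1); 37(d + 1) ≤ 74 d since d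
≥ 1. -/
theorem card_bound_le {B : ℝ} {s d : ℕ} (hB : 2 ≤ B) (hd : 1 ≤ d)
    (hN : (s : ℝ) + (d + 1) + 1 ≤ B ^ 12) :
    ((((s + (d + 1) + 1) ^ (d + 1)) ^ 2 * (2 * (s + (d + 1))) ^ (d + 1) : ℕ) : ℝ) ≤
      B ^ (74 * d) := by
  push_cast
  calc _ ≤ ((B ^ 12) ^ (d + 1)) ^ 2 * (B * B ^ 12) ^ (d + 1) := by
        gcongr
        linarith
    _ = B ^ (37 * (d + 1)) := by ring
    _ ≤ B ^ (74 * d) := pow_le_pow_right₀ (by linarith) (by omega)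

end Numerics

/-! ### Halfspaces as positive sets of functionals -/

theorem exists_le_iff_lt {T : Set ℝ} (hT : T.Finite) (b : ℝ) : ∃ b', ∀ r ∈ T, r ≤ b ↔ r < b' := by
  -- Only finitely many values matter, so any `b'` slightly above `b` works.
  have h : ∀ᶠ b' in nhdsWithin b (Set.Ioi b), ∀ r ∈ T, r ≤ b ↔ r < b' := by
    rw [Filter.eventually_all_finite hT]
    intro r _
    rcases le_or_gt r b with h | h
    · filter_upwards [self_mem_nhdsWithin] with b' hb'
      exact ⟨fun _ => h.trans_lt hb', fun _ => h⟩
    · filter_upwards [nhdsWithin_le_nhds (Iio_mem_nhds h)] with b' hb'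
      exact ⟨fun h' => absurd h' h.not_ge, fun h' => absurd hb' h'.not_gt⟩
  exact h.exists

/-- The functional on pairs `(a, b)` that is positive where `⟪a, x⟫ < b`. -/
noncomputable def slack {E : Type*} [NormedAddCommGroup E] [InnerProductSpace ℝ E] (x : E) :
    Dual ℝ (E × ℝ) :=
  LinearMap.snd ℝ E ℝ - (innerₗ E x) ∘ₗ LinearMap.fst ℝ E ℝ

theorem slack_apply {E : Type*} [NormedAddCommGroup E] [InnerProductSpace ℝ E] (x a : E) (b : ℝ) :
    slack x (a, b) = b - inner ℝ a x := by
  simp [slack, real_inner_comm]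

theorem exists_slack_of_mem_halfspacesOn {d : ℕ} {U : Set (EuclideanSpace ℝ (Fin d))}
    (hU : U.Finite) {F : Set (EuclideanSpace ℝ (Fin d))} (hF : F ∈ halfspacesOn U) :
    ∃ p, F = {x ∈ U | 0 < slack x p} := by
  obtain ⟨H, ⟨a, b, -, rfl | rfl⟩, rfl⟩ := hF
  · refine ⟨(a, b), Set.ext fun x => ?_⟩
    simp [slack_apply, and_comm]
  · obtain ⟨b', hb'⟩ := exists_le_iff_lt (hU.image fun x => inner ℝ a x) b
    refine ⟨(a, b'), Set.ext fun x => ?_⟩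
    simp only [Set.mem_inter_iff, Set.mem_ofPred_eq, slack_apply, sub_pos]
    rw [and_comm]
    exact and_congr_right fun hx => hb' _ ⟨x, hx, rfl⟩

theorem subset_of_mem_halfspacesOn {d : ℕ} {U F : Set (EuclideanSpace ℝ (Fin d))}
    (hF : F ∈ halfspacesOn U) : F ⊆ U := by
  obtain ⟨H, -, rfl⟩ := hF
  exact Set.inter_subset_right

end HalfspaceContainers

open HalfspaceContainers in
theorem mainTheorem1 :
    ∃ K : ℕ, ∀ (d : ℕ), 1 ≤ d → ∀ (U : Set (EuclideanSpace ℝ (Fin d))), U.Finite →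
      ∀ ε : ℝ, 0 < ε →
        ∃ 𝓒 : Set (Set (EuclideanSpace ℝ (Fin d))),
          IsContainerFamily U (halfspacesOn U) 𝓒 ε ∧
            𝓒.Finite ∧ (𝓒.ncard : ℝ) ≤ (max 2 ((d : ℝ) / ε)) ^ (K * d) := by
  classical
  refine ⟨74, fun d hd U hU ε hε => ?_⟩
  have hB : (2 : ℝ) ≤ max 2 (d / ε) := le_max_left _ _
  -- Here `U` itself is a container; otherwise ε < 1, which gives d ≤ d/ε and lets the sampling
  -- argument run.
  by_cases htriv : U = ∅ ∨ 1 ≤ ε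
  · refine ⟨{U}, ⟨by simp, fun F hF => ⟨U, rfl, subset_of_mem_halfspacesOn hF, ?_⟩⟩,
      Set.finite_singleton U, ?_⟩
    · rcases htriv with rfl | h
      · simp
      · calc ((U \ F).ncard : ℝ) ≤ U.ncard := by exact_mod_cast Set.ncard_le_ncard Set.sdiff_subset hU
          _ ≤ ε * U.ncard := le_mul_of_one_le_left (Nat.cast_nonneg _) h
    · rw [Set.ncard_singleton, Nat.cast_one]
      exact one_le_pow₀ (by linarith)
  push Not at htriv
  obtain ⟨hne, hε₁⟩ := htriv
  have hd' : (1 : ℝ) ≤ d := by exact_mod_cast hd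
  have hBε : ε⁻¹ ≤ max 2 (d / ε) := by
    refine le_trans ?_ (le_max_right _ _)
    rw [div_eq_mul_inv]
    exact le_mul_of_one_le_left (inv_nonneg.2 hε.le) hd'
  have hBd : (d : ℝ) ≤ max 2 (d / ε) :=
    le_trans (le_div_self (by linarith) hε hε₁.le) (le_max_right _ _)
  generalize max 2 ((d : ℝ) / ε) = B at *
  have hs := Nat.le_ceil (B ^ 11)
  have hN : (⌈B ^ 11⌉₊ : ℝ) + (d + 1) + 1 ≤ B ^ 12 := by
    have h₁ := Nat.ceil_lt_add_one (show 0 ≤ B ^ 11 by positivity)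
    have h₂ : (2 : ℝ) ^ 10 ≤ B ^ 10 := by gcongr
    have h₃ : B ^ 11 = B * B ^ 10 := by ring
    have h₄ : B ^ 12 = B * B ^ 11 := by ring
    nlinarith
  have : Fintype U := hU.fintype
  have : Nonempty U := hne.to_subtype
  obtain ⟨𝒞, hcard, h𝒞⟩ := exists_containers (V := EuclideanSpace ℝ (Fin d) × ℝ)
    (fun x : U => slack (x : EuclideanSpace ℝ (Fin d))) (s := ⌈B ^ 11⌉₊) (d := d) (by simp)
    hε.le hε₁.le (pow_mul_one_sub_pow_lt_one hB hε hε₁.le hBε hd hBd hs (by linarith))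
  refine ⟨(fun C : Finset U => Subtype.val '' (C : Set U)) '' (𝒞 : Set (Finset U)), ⟨?_, ?_⟩,
    𝒞.finite_toSet.image _, ?_⟩
  · rintro _ ⟨C, -, rfl⟩
    exact Subtype.coe_image_subset U _
  · intro F hF
    obtain ⟨p, rfl⟩ := exists_slack_of_mem_halfspacesOn hU hF
    obtain ⟨C, hC, hsub, hsmall⟩ := h𝒞 p
    refine ⟨_, ⟨C, hC, rfl⟩, fun x hx => ⟨⟨x, hx.1⟩, hsub _ hx.2, rfl⟩, ?_⟩
    have heq : (Subtype.val '' (C : Set U)) \ {x ∈ U | 0 < slack x p} =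
        Subtype.val '' (({x ∈ C | slack (x : EuclideanSpace ℝ (Fin d)) p ≤ 0} : Finset U) :
          Set U) := by
      ext x
      simp only [Set.mem_sdiff, Set.mem_image, Set.mem_ofPred_eq, coe_filter, mem_coe]
      constructor
      · rintro ⟨⟨y, hy, rfl⟩, h⟩
        exact ⟨y, ⟨hy, not_lt.1 fun h' => h ⟨y.2, h'⟩⟩, rfl⟩
      · rintro ⟨y, ⟨hy, hy'⟩, rfl⟩
        exact ⟨⟨y, hy, rfl⟩, fun h => h.2.not_ge hy'⟩
    rw [heq, Set.ncard_image_of_injective _ Subtype.val_injective, Set.ncard_coe_finset,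
      ← Nat.card_coe_set_eq, Nat.card_eq_fintype_card]
    convert hsmall
  · refine le_trans (Nat.cast_le.2 ((Set.ncard_image_le 𝒞.finite_toSet).trans ?_))
      (card_bound_le hB hd hN)
    rwa [Set.ncard_coe_finset]
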